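/- Let $d\ge 1$, let $X$ be an $\mathbb R^d$-valued random variable on a probability space $(\Omega,\mathcal F,\mathbf P)$, and let $N\in L^2(\Omega\to\mathbb R^d;\mathbf P)$ be such that $$\mathbf E\,(\nabla f)(X)=\mathbf E\{f(X)N\}\qquad\text{for all } f\in C_b^1(\mathbb R^d),$$ where $C^1_b(\mathbb R^d)$ is the set of bounded continuously differentiable functions $f:\mathbb R^d\to\mathbb R$ with bounded first derivatives. Then: (1) The distribution $\mathbf P_X$ of $X$ has a density $\rho\ge 0$ with respect to Lebesgue measure. The density is locally integrable with a locally integrable weak gradient $\nabla\rho$, and, writing $\nabla\log\rho:=\nabla\rho/\rho$ on $\{\rho>0\}$ (a set of full $\mathbf P_X$-measure), $$\nabla\log\rho(x)=-\mathbf E(N\mid X=x)\qquad\text{for } \mathbf P_X\text{-a.e. } x.$$ Consequently, for every $e\in\mathbb R^d$ and every nonnegative, nondecreasing convex function $H:[0,\infty)\to[0,\infty)$, $$\int_{\mathbb R^d} H\bigl(|\langle e,\nabla\log\rho(x)\rangle|\bigr)\,\rho(x)\,dx\le \mathbf E\,H\bigl(|\langle e,N\rangle|\bigr),$$ where both sides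 may be $+\infty$, and the integrand on the left is $0$ where $\rho=0$. (2) For every continuously differentiable, compactly supported vector field $U:\mathbb R^d\to\mathbb R^d$ and every $f\in C^1(\mathbb R^d)$, the random variables $(\nabla_U f)(X)$ and $f(X)\bigl(\langle U(X),N\rangle-(\operatorname{div}U)(X)\bigr)$ are integrable and $$\mathbf E\,(\nabla_U f)(X)=\mathbf E\bigl\{f(X)\bigl(\langle U(X),N\rangle-(\operatorname{div}U)(X)\bigr)\bigr\},$$ where $\nabla_U f=\langle U,\nabla f\rangle$. -/

import Mathlib

open MeasureTheory ProbabilityTheory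
open scoped InnerProductSpace

noncomputable section

/-- The class `C_b^1(ℝ^d)`: bounded continuously differentiable functions with bounded
derivative. -/
def IsCb1 {d : ℕ} (f : EuclideanSpace ℝ (Fin d) → ℝ) : Prop :=
  ContDiff ℝ 1 f ∧ (∃ C : ℝ, ∀ x, |f x| ≤ C) ∧ (∃ C : ℝ, ∀ x, ‖fderiv ℝ f x‖ ≤ C)

/-- The divergence `∑ i, ∂ᵢ Uᵢ` of a vector field on `ℝ^d`. -/
def euclideanDiv {d : ℕ} (U : EuclideanSpace ℝ (Fin d) → EuclideanSpace ℝ (Fin d))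
    (x : EuclideanSpace ℝ (Fin d)) : ℝ :=
  ∑ i : Fin d, (fderiv ℝ U x (EuclideanSpace.single i 1)) i

/-- `G` is the weak (distributional) gradient of `ρ` on `ℝ^d`: both are locally integrable and
`∫ ρ ∇φ = - ∫ φ G` for all smooth compactly supported `φ`. It is unique up to null sets. -/
def HasWeakGradient {d : ℕ} (ρ : EuclideanSpace ℝ (Fin d) → ℝ)
    (G : EuclideanSpace ℝ (Fin d) → EuclideanSpace ℝ (Fin d)) : Prop :=
  LocallyIntegrable ρ volume ∧ LocallyIntegrable G volume ∧
    ∀ φ : EuclideanSpace ℝ (Fin d) → ℝ, ContDiff ℝ ((⊤ : ℕ∞) : WithTop ℕ∞) φ → HasCompactSupport φ →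
      ∫ x, ρ x • gradient φ x = -∫ x, φ x • G x

/-- The logarithmic gradient `∇ log ρ = ∇ρ / ρ` on `{ρ > 0}` of a density `ρ` with weak gradient
`G` (on the set `{ρ = 0}`, which is null for the measure `ρ dx`, the value is `0`). -/
def logGradient {d : ℕ} (ρ : EuclideanSpace ℝ (Fin d) → ℝ)
    (G : EuclideanSpace ℝ (Fin d) → EuclideanSpace ℝ (Fin d))
    (x : EuclideanSpace ℝ (Fin d)) : EuclideanSpace ℝ (Fin d) :=
  (ρ x)⁻¹ • G x

/-- `E(N | X = x)`: the mean of the regular conditional distribution of `N` given `X = x`. -/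
def condMeanGiven {Ω : Type*} [MeasurableSpace Ω] {d : ℕ} (P : Measure Ω) [IsFiniteMeasure P]
    (N X : Ω → EuclideanSpace ℝ (Fin d)) (x : EuclideanSpace ℝ (Fin d)) :
    EuclideanSpace ℝ (Fin d) :=
  ∫ n, n ∂(condDistrib N X P x)

end

/-!
Write `μ` for the law of `X` and `m(x) = E(N | X = x)`.

The existence of a density rests on the behaviour of `μ` under translations. For `f` in `C_b^1`,
differentiating `t ↦ E f(X + t v)` and integrating by parts gives
`|E f(X + v) - E f(X)| ≤ ‖f‖_∞ E‖N‖ ‖v‖` (`abs_integral_comp_add_sub_le`), a bound that does not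
see the derivative of `f`. Applied to powers of a bump function equal to `1` exactly on a compact
set `K`, it yields `μ(K) ≤ μ(K - v) + E‖N‖ ‖v‖` (`measureReal_map_le_translate`). If `K` is Lebesgue
null, Fubini's theorem shows `μ(K - v) = 0` for almost every `v`; letting such `v` tend to `0` gives
`μ(K) = 0`, and inner regularity gives `μ ≪ volume`
(`absolutelyContinuous_of_isCompact_le_translate`).

Let `ρ` be the Radon-Nikodym derivative. The disintegration of the law of `(X, N)` turns the
hypothesis into `∫ ρ ∇φ = ∫ φ ρ m`, so `-ρ m` is the weak gradient of `ρ`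
(`hasWeakGradient_rnDeriv`) and `∇ρ / ρ = -m` where `ρ > 0`. The inequality for convex `H` is then
the conditional Jensen inequality for the convex function `r ↦ H |r|`
(`lintegral_convex_inner_condMeanGiven_le`). The formula for vector fields is the hypothesis applied
to the functions `f Uᵢ` (`integral_fderiv_apply_vectorField`).
-/

/-! ### Absolute continuity from translation estimates -/

/-- A measure `μ` whose mass on compact sets changes at most linearly under translation is absolutely
continuous with respect to Haar measure `ν`: a compact `ν`-null set has `μ`-null translates by
almost every, hence by arbitrarily small, vectors. -/
theorem absolutelyContinuous_of_isCompact_le_translate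
    {E : Type*} [NormedAddCommGroup E] [SecondCountableTopology E] [CompleteSpace E]
    [MeasurableSpace E] [BorelSpace E]
    {μ ν : Measure E} [IsFiniteMeasure μ] [SFinite ν] [ν.IsAddLeftInvariant] [ν.IsOpenPosMeasure]
    {C : ℝ}
    (h : ∀ K : Set E, IsCompact K → ∀ v : E,
      μ.real K ≤ μ.real ((fun x => x + v) ⁻¹' K) + C * ‖v‖) :
    μ ≪ ν := by
  have key : ∀ K : Set E, IsCompact K → ν K = 0 → μ K = 0 := by
    intro K hK hνK
    have hmeas : MeasurableSet {p : E × E | p.2 + p.1 ∈ K} :=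
      (measurable_snd.add measurable_fst) hK.measurableSet
    -- By Fubini almost every translate of `K` is `μ`-null.
    have hprod : (ν.prod μ) {p : E × E | p.2 + p.1 ∈ K} = 0 := by
      rw [Measure.prod_apply_symm hmeas]
      refine (lintegral_congr fun x => ?_).trans lintegral_zero
      exact (measure_preimage_add ν x K).trans hνK
    have hae : ∀ᵐ v ∂ν, μ ((fun x => x + v) ⁻¹' K) = 0 :=
      (Measure.measure_prod_null hmeas).1 hprod
    have hdense := Measure.dense_of_ae hae
    have hclosed : IsClosed {v : E | μ.real K ≤ C * ‖v‖} :=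
      isClosed_le continuous_const (by fun_prop)
    have hsub : {v : E | μ ((fun x => x + v) ⁻¹' K) = 0} ⊆ {v : E | μ.real K ≤ C * ‖v‖} := by
      intro v hv
      have := h K hK v
      simp only [Set.mem_ofPred_eq] at hv ⊢
      simpa [Measure.real, hv] using this
    have h0 : (0 : E) ∈ {v : E | μ.real K ≤ C * ‖v‖} :=
      closure_minimal hsub hclosed (hdense 0)
    have : μ.real K = 0 := le_antisymm (by simpa using h0) measureReal_nonneg
    simpa [Measure.real, ENNReal.toReal_eq_zero_iff] using this
  refine Measure.AbsolutelyContinuous.mk fun s hs hνs => ?_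
  rw [hs.measure_eq_iSup_isCompact]
  simp only [ENNReal.iSup_eq_zero]
  exact fun K hKs hK => key K hK (measure_mono_null hKs hνs)

/-! ### Test functions -/

theorem IsCb1.of_hasCompactSupport {d : ℕ} {f : EuclideanSpace ℝ (Fin d) → ℝ}
    (hf : ContDiff ℝ 1 f) (hc : HasCompactSupport f) : IsCb1 f :=
  ⟨hf, hc.exists_bound_of_continuous hf.continuous,
    (hc.fderiv ℝ).exists_bound_of_continuous (hf.continuous_fderiv one_ne_zero)⟩

/-- The powers of such a function `g` decrease pointwise to the indicator function of `K`. -/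
theorem IsCompact.exists_contDiff_eq_one_iff {d : ℕ} {K : Set (EuclideanSpace ℝ (Fin d))}
    (hK : IsCompact K) :
    ∃ g : EuclideanSpace ℝ (Fin d) → ℝ, ContDiff ℝ 1 g ∧ HasCompactSupport g ∧
      (∀ x, 0 ≤ g x ∧ g x ≤ 1) ∧ ∀ x, g x = 1 ↔ x ∈ K := by
  -- Vanishing outside a ball containing `K` ensures compact support.
  obtain ⟨r, hr⟩ := hK.isBounded.subset_ball 0
  obtain ⟨g, hg, hrange, h0, h1⟩ := exists_contMDiff_zero_iff_one_iff_of_isClosed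
    (modelWithCornersSelf ℝ (EuclideanSpace ℝ (Fin d))) (n := 1)
    (s := (Metric.ball (0 : EuclideanSpace ℝ (Fin d)) r)ᶜ) (t := K)
    Metric.isOpen_ball.isClosed_compl hK.isClosed
    (Set.disjoint_compl_left_iff_subset.2 hr)
  refine ⟨g, hg.contDiff, ?_, fun x => hrange ⟨x, rfl⟩, fun x => (h1 x).symm⟩
  refine HasCompactSupport.intro (isCompact_closedBall (0 : EuclideanSpace ℝ (Fin d)) r)
    fun x hx => (h0 x).1 fun hx' => hx (Metric.ball_subset_closedBall hx')

section

variable {Ω : Type*} [MeasurableSpace Ω] {P : Measure Ω} {d : ℕ}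
  {X N : Ω → EuclideanSpace ℝ (Fin d)}

theorem IsCb1.integrable_comp [IsFiniteMeasure P] (hX : Measurable X)
    {f : EuclideanSpace ℝ (Fin d) → ℝ} (hf : IsCb1 f) : Integrable (fun ω => f (X ω)) P := by
  obtain ⟨hf1, ⟨C, hC⟩, -⟩ := hf
  exact Integrable.of_bound (hf1.continuous.measurable.comp hX).aestronglyMeasurable C
    (.of_forall fun ω => hC _)

theorem IsCb1.integrable_gradient_comp [IsFiniteMeasure P] (hX : Measurable X)
    {f : EuclideanSpace ℝ (Fin d) → ℝ} (hf : IsCb1 f) :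
    Integrable (fun ω => gradient f (X ω)) P := by
  obtain ⟨hf1, -, ⟨C, hC⟩⟩ := hf
  have hcont : Continuous (gradient f) :=
    (InnerProductSpace.toDual ℝ _).symm.continuous.comp (hf1.continuous_fderiv one_ne_zero)
  refine Integrable.of_bound (hcont.measurable.comp hX).aestronglyMeasurable C
    (.of_forall fun ω => ?_)
  rw [gradient, LinearIsometryEquiv.norm_map]
  exact hC _

theorem IsCb1.integrable_smul [IsFiniteMeasure P] (hX : Measurable X) (hN : Integrable N P)
    {f : EuclideanSpace ℝ (Fin d) → ℝ} (hf : IsCb1 f) :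
    Integrable (fun ω => f (X ω) • N ω) P := by
  obtain ⟨hf1, ⟨C, hC⟩, -⟩ := hf
  exact hN.bdd_smul C (hf1.continuous.measurable.comp hX).aestronglyMeasurable
    (.of_forall fun ω => hC _)

/-! ### Translation estimate for the law of `X` -/

/-- The integration by parts formula in the direction `v`. -/
theorem integral_fderiv_apply_eq [IsFiniteMeasure P] (hX : Measurable X) (hN : Integrable N P)
    (hIBP : ∀ f : EuclideanSpace ℝ (Fin d) → ℝ, IsCb1 f →
      ∫ ω, gradient f (X ω) ∂P = ∫ ω, f (X ω) • N ω ∂P)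
    {f : EuclideanSpace ℝ (Fin d) → ℝ} (hf : IsCb1 f) (v : EuclideanSpace ℝ (Fin d)) :
    ∫ ω, fderiv ℝ f (X ω) v ∂P = ∫ ω, f (X ω) * ⟪v, N ω⟫_ℝ ∂P := by
  have h := congrArg (fun w => ⟪v, w⟫_ℝ) (hIBP f hf)
  rw [← integral_inner (hf.integrable_gradient_comp hX),
    ← integral_inner (hf.integrable_smul hX hN)] at h
  simpa [inner_gradient_right, real_inner_smul_right] using h

theorem IsCb1.comp_add_right {f : EuclideanSpace ℝ (Fin d) → ℝ} (hf : IsCb1 f)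
    (v : EuclideanSpace ℝ (Fin d)) : IsCb1 fun x => f (x + v) := by
  obtain ⟨hf1, ⟨C, hC⟩, ⟨D, hD⟩⟩ := hf
  refine ⟨hf1.comp (contDiff_id.add contDiff_const), ⟨C, fun x => hC _⟩, ⟨D, fun x => ?_⟩⟩
  rw [fderiv_comp_add_right]
  exact hD _

/-- The bound involves `f` only through its supremum: the derivative of `t ↦ E f(X + t v)` is
`E ⟪v, ∇f(X + t v)⟫`, which integration by parts turns into `E f(X + t v) ⟪v, N⟫`. -/
theorem abs_integral_comp_add_sub_le [IsFiniteMeasure P] (hX : Measurable X) (hN : Integrable N P)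
    (hIBP : ∀ f : EuclideanSpace ℝ (Fin d) → ℝ, IsCb1 f →
      ∫ ω, gradient f (X ω) ∂P = ∫ ω, f (X ω) • N ω ∂P)
    {f : EuclideanSpace ℝ (Fin d) → ℝ} (hf : IsCb1 f) {C : ℝ} (hC : ∀ x, |f x| ≤ C)
    (v : EuclideanSpace ℝ (Fin d)) :
    |∫ ω, f (X ω + v) ∂P - ∫ ω, f (X ω) ∂P| ≤ C * (∫ ω, ‖N ω‖ ∂P) * ‖v‖ := by
  obtain ⟨D, hD⟩ := hf.2.2
  have hderiv : ∀ t : ℝ, HasDerivAt (fun s : ℝ => ∫ ω, f (X ω + s • v) ∂P)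
      (∫ ω, fderiv ℝ f (X ω + t • v) v ∂P) t := by
    intro t
    refine (hasDerivAt_integral_of_dominated_loc_of_deriv_le
      (F' := fun s ω => fderiv ℝ f (X ω + s • v) v) (bound := fun _ => D * ‖v‖)
      Filter.univ_mem (.of_forall fun s => ?_) ((hf.comp_add_right (t • v)).integrable_comp hX)
      ?_ (.of_forall fun ω s _ => ?_) (integrable_const _) (.of_forall fun ω s _ => ?_)).2
    · exact ((hf.comp_add_right (s • v)).integrable_comp hX).aestronglyMeasurable
    · have : Continuous fun x => fderiv ℝ f (x + t • v) v :=
        ((hf.1.continuous_fderiv one_ne_zero).comp (by fun_prop)).clm_apply continuous_const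
      exact (this.measurable.comp hX).aestronglyMeasurable
    · exact (fderiv ℝ f _).le_of_opNorm_le (hD _) v
    · have h1 : HasDerivAt (fun s : ℝ => X ω + s • v) v s := by
        simpa using ((hasDerivAt_id s).smul_const v).const_add (X ω)
      exact ((hf.1.differentiable one_ne_zero _).hasFDerivAt).comp_hasDerivAt s h1
  have hbound : ∀ t : ℝ, ‖∫ ω, fderiv ℝ f (X ω + t • v) v ∂P‖
      ≤ C * (∫ ω, ‖N ω‖ ∂P) * ‖v‖ := by
    intro t
    have h := integral_fderiv_apply_eq hX hN hIBP (hf.comp_add_right (t • v)) v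
    simp only [fderiv_comp_add_right] at h
    have hC0 : 0 ≤ C := (abs_nonneg _).trans (hC 0)
    rw [h, ← integral_const_mul, ← integral_mul_const]
    refine norm_integral_le_of_norm_le ((hN.norm.const_mul C).mul_const ‖v‖)
      (.of_forall fun ω => ?_)
    rw [norm_mul, mul_assoc, mul_comm ‖N ω‖]
    exact mul_le_mul (hC _) (norm_inner_le_norm _ _) (norm_nonneg _) hC0
  simpa using norm_image_sub_le_of_norm_deriv_le_segment_01'
    (fun t _ => (hderiv t).hasDerivWithinAt) (fun t _ => hbound t)

/-- The translation bound on integrals of `C_b^1` functions bounded by `1` passes to compact sets. -/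
theorem measureReal_map_le_translate [IsProbabilityMeasure P] (hX : Measurable X)
    (hN : Integrable N P)
    (hIBP : ∀ f : EuclideanSpace ℝ (Fin d) → ℝ, IsCb1 f →
      ∫ ω, gradient f (X ω) ∂P = ∫ ω, f (X ω) • N ω ∂P)
    {K : Set (EuclideanSpace ℝ (Fin d))} (hK : IsCompact K) (v : EuclideanSpace ℝ (Fin d)) :
    (P.map X).real K ≤ (P.map X).real ((fun x => x + v) ⁻¹' K) + (∫ ω, ‖N ω‖ ∂P) * ‖v‖ := by
  obtain ⟨g, hg, hgc, hg01, hgK⟩ := hK.exists_contDiff_eq_one_iff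
  have hlim : ∀ w : EuclideanSpace ℝ (Fin d), Filter.Tendsto
      (fun n : ℕ => ∫ ω, g (X ω + w) ^ (n + 1) ∂P) Filter.atTop
      (nhds ((P.map X).real ((fun x => x + w) ⁻¹' K))) := by
    intro w
    have hmeas : MeasurableSet ((fun ω => X ω + w) ⁻¹' K) :=
      (hX.add_const w) hK.measurableSet
    have h1 : (P.map X).real ((fun x => x + w) ⁻¹' K)
        = ∫ ω, ((fun ω => X ω + w) ⁻¹' K).indicator 1 ω ∂P := by
      rw [integral_indicator_one hmeas, Measure.real, Measure.real,
        Measure.map_apply hX ((measurable_add_const w) hK.measurableSet)]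
      rfl
    rw [h1]
    refine tendsto_integral_of_dominated_convergence (fun _ => 1) (fun n => ?_)
      (integrable_const _) (fun n => .of_forall fun ω => ?_) (.of_forall fun ω => ?_)
    · exact (((hg.continuous.measurable.comp (measurable_add_const w)).comp hX).pow_const
        _).aestronglyMeasurable
    · rw [Real.norm_of_nonneg (pow_nonneg (hg01 _).1 _)]
      exact pow_le_one₀ (hg01 _).1 (hg01 _).2
    · by_cases hω : X ω + w ∈ K
      · have : ω ∈ (fun ω => X ω + w) ⁻¹' K := hω
        simp [Set.indicator_of_mem this, (hgK _).2 hω]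
      · have : ω ∉ (fun ω => X ω + w) ⁻¹' K := hω
        rw [Set.indicator_of_notMem this]
        exact (tendsto_pow_atTop_nhds_zero_of_lt_one (hg01 _).1
          (lt_of_le_of_ne (hg01 _).2 fun h => hω ((hgK _).1 h))).comp
            (Filter.tendsto_add_atTop_nat 1)
  have h0 := hlim 0
  simp only [add_zero, Set.preimage_id'] at h0
  refine le_of_tendsto_of_tendsto' h0 ((hlim v).add_const _) fun n => ?_
  have hCb : IsCb1 fun x => g x ^ (n + 1) :=
    .of_hasCompactSupport (hg.pow _) (hgc.comp_left (g := fun y : ℝ => y ^ (n + 1)) (by simp))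
  have := abs_integral_comp_add_sub_le hX hN hIBP hCb (C := 1) (fun x => by
    rw [abs_of_nonneg (pow_nonneg (hg01 x).1 _)]
    exact pow_le_one₀ (hg01 x).1 (hg01 x).2) v
  rw [one_mul] at this
  linarith [(abs_le.1 this).1]

theorem map_absolutelyContinuous_volume [IsProbabilityMeasure P] (hX : Measurable X)
    (hN : Integrable N P)
    (hIBP : ∀ f : EuclideanSpace ℝ (Fin d) → ℝ, IsCb1 f →
      ∫ ω, gradient f (X ω) ∂P = ∫ ω, f (X ω) • N ω ∂P) :
    P.map X ≪ volume :=
  have := Measure.isProbabilityMeasure_map (μ := P) hX.aemeasurable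
  absolutelyContinuous_of_isCompact_le_translate
    fun _ hK v => measureReal_map_le_translate hX hN hIBP hK v

/-! ### Conditional mean and disintegration -/

theorem measurable_condMeanGiven [IsFiniteMeasure P] : Measurable (condMeanGiven P N X) :=
  (StronglyMeasurable.integral_condDistrib
    (f := fun p : EuclideanSpace ℝ (Fin d) × EuclideanSpace ℝ (Fin d) => p.2)
    measurable_snd.stronglyMeasurable).measurable

theorem integrable_snd_map_prodMk [IsFiniteMeasure P] (hX : Measurable X) (hN : Integrable N P) :
    Integrable (fun p : EuclideanSpace ℝ (Fin d) × EuclideanSpace ℝ (Fin d) => p.2)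
      (P.map fun ω => (X ω, N ω)) :=
  (integrable_map_measure measurable_snd.aestronglyMeasurable
    (hX.aemeasurable.prodMk hN.aemeasurable)).2 hN

theorem integrable_condMeanGiven [IsFiniteMeasure P] (hX : Measurable X) (hN : Integrable N P) :
    Integrable (condMeanGiven P N X) (P.map X) :=
  (integrable_snd_map_prodMk hX hN).integral_condDistrib_map hN.aemeasurable

/-- `E(N | X)` may replace `N` when integrated against functions of `X`. -/
theorem integral_smul_condMeanGiven [IsFiniteMeasure P] (hX : Measurable X) (hN : Integrable N P)
    {f : EuclideanSpace ℝ (Fin d) → ℝ} (hf : IsCb1 f) :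
    ∫ x, f x • condMeanGiven P N X x ∂(P.map X) = ∫ ω, f (X ω) • N ω ∂P := by
  have hpair : AEMeasurable (fun ω => (X ω, N ω)) P := hX.aemeasurable.prodMk hN.aemeasurable
  have hF : AEStronglyMeasurable
      (fun p : EuclideanSpace ℝ (Fin d) × EuclideanSpace ℝ (Fin d) => f p.1 • p.2)
      (P.map fun ω => (X ω, N ω)) :=
    ((hf.1.continuous.comp continuous_fst).smul continuous_snd).aestronglyMeasurable
  have hint := (integrable_map_measure hF hpair).2 (hf.integrable_smul hX hN)
  rw [← integral_map hpair hF]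
  rw [← compProd_map_condDistrib hN.aemeasurable] at hint ⊢
  rw [Measure.integral_compProd hint]
  exact integral_congr_ae (.of_forall fun x => (integral_smul _ _).symm)

/-! ### Conditional Jensen inequality -/

theorem ConvexOn.comp_abs {H : ℝ → ℝ} (hH : ConvexOn ℝ (Set.Ici 0) H)
    (hmono : MonotoneOn H (Set.Ici 0)) : ConvexOn ℝ Set.univ fun r => H |r| := by
  refine ⟨convex_univ, fun x _ y _ a b ha hb hab => ?_⟩
  refine le_trans (hmono (Set.mem_Ici.2 (abs_nonneg _)) 
    (Set.mem_Ici.2 (by simp only [smul_eq_mul]; positivity) : a • |x| + b • |y| ∈ Set.Ici 0) ?_)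
    (hH.2 (abs_nonneg x) (abs_nonneg y) ha hb hab)
  simp only [smul_eq_mul]
  calc |a * x + b * y| ≤ |a * x| + |b * y| := abs_add_le _ _
    _ = a * |x| + b * |y| := by rw [abs_mul, abs_mul, abs_of_nonneg ha, abs_of_nonneg hb]

/-- Jensen's inequality without the assumption that `φ ∘ Y` is integrable: if it is not, the
right-hand side is `∞`. -/
theorem ofReal_map_integral_le_lintegral {α : Type*} [MeasurableSpace α] {μ : Measure α}
    [IsProbabilityMeasure μ] {φ : ℝ → ℝ} (hφ : ConvexOn ℝ Set.univ φ) (hφ0 : ∀ r, 0 ≤ φ r)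
    {Y : α → ℝ} (hY : Integrable Y μ) :
    ENNReal.ofReal (φ (∫ a, Y a ∂μ)) ≤ ∫⁻ a, ENNReal.ofReal (φ (Y a)) ∂μ := by
  have hcont : Continuous φ :=
    continuousOn_univ.1 (hφ.continuousOn isOpen_univ)
  have hm : AEStronglyMeasurable (fun a => φ (Y a)) μ :=
    hcont.comp_aestronglyMeasurable hY.aestronglyMeasurable
  by_cases hint : Integrable (fun a => φ (Y a)) μ
  · rw [← ofReal_integral_eq_lintegral_ofReal hint (.of_forall fun a => hφ0 _)]
    exact ENNReal.ofReal_le_ofReal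
      (hφ.map_integral_le hcont.continuousOn isClosed_univ (by simp) hY hint)
  · rw [← lintegral_ofReal_ne_top_iff_integrable hm (.of_forall fun a => hφ0 _), not_not] at hint
    rw [hint]
    exact le_top

/-- Conditional Jensen inequality, obtained by applying Jensen's inequality to almost every
conditional distribution of `N` given `X = x`. -/
theorem lintegral_convex_inner_condMeanGiven_le [IsFiniteMeasure P] (hX : Measurable X)
    (hN : Integrable N P) (e : EuclideanSpace ℝ (Fin d)) {φ : ℝ → ℝ}
    (hφ : ConvexOn ℝ Set.univ φ) (hφ0 : ∀ r, 0 ≤ φ r) :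
    ∫⁻ x, ENNReal.ofReal (φ ⟪e, condMeanGiven P N X x⟫_ℝ) ∂(P.map X) ≤
      ∫⁻ ω, ENNReal.ofReal (φ ⟪e, N ω⟫_ℝ) ∂P := by
  have hcont : Continuous φ := continuousOn_univ.1 (hφ.continuousOn isOpen_univ)
  have hmeas : Measurable fun p : EuclideanSpace ℝ (Fin d) × EuclideanSpace ℝ (Fin d) =>
      ENNReal.ofReal (φ ⟪e, p.2⟫_ℝ) := by fun_prop
  have hpair : AEMeasurable (fun ω => (X ω, N ω)) P := hX.aemeasurable.prodMk hN.aemeasurable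
  calc ∫⁻ x, ENNReal.ofReal (φ ⟪e, condMeanGiven P N X x⟫_ℝ) ∂(P.map X)
      ≤ ∫⁻ x, ∫⁻ n, ENNReal.ofReal (φ ⟪e, n⟫_ℝ) ∂(condDistrib N X P x) ∂(P.map X) := by
        refine lintegral_mono_ae ?_
        filter_upwards [(integrable_snd_map_prodMk hX hN).condDistrib_ae_map hN.aemeasurable]
          with x hx
        rw [condMeanGiven, ← integral_inner hx]
        exact ofReal_map_integral_le_lintegral hφ hφ0 (hx.const_inner e)
    _ = ∫⁻ ω, ENNReal.ofReal (φ ⟪e, N ω⟫_ℝ) ∂P := by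
        rw [← lintegral_map' hmeas.aemeasurable hpair, ← compProd_map_condDistrib hN.aemeasurable,
          Measure.lintegral_compProd hmeas]

/-! ### Integration by parts along vector fields -/

theorem fderiv_mul_apply_single {f : EuclideanSpace ℝ (Fin d) → ℝ}
    {U : EuclideanSpace ℝ (Fin d) → EuclideanSpace ℝ (Fin d)}
    (hf : Differentiable ℝ f) (hU : Differentiable ℝ U) (x v : EuclideanSpace ℝ (Fin d))
    (i : Fin d) :
    fderiv ℝ (fun y => f y * U y i) x v = U x i * fderiv ℝ f x v + f x * (fderiv ℝ U x v) i := by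
  have hUi : HasFDerivAt (fun y => U y i) ((EuclideanSpace.proj i).comp (fderiv ℝ U x)) x :=
    (EuclideanSpace.proj (𝕜 := ℝ) i).hasFDerivAt.comp x (hU x).hasFDerivAt
  have h : HasFDerivAt (fun y => f y * U y i) _ x := (hf x).hasFDerivAt.mul hUi
  rw [h.fderiv]
  simp [add_comm]


/-- Integration by parts along `U` is integration by parts in the `i`-th coordinate direction for the
compactly supported function `f Uᵢ`, summed over `i`. -/
theorem integral_fderiv_apply_vectorField [IsFiniteMeasure P] (hX : Measurable X)
    (hN : Integrable N P)
    (hIBP : ∀ f : EuclideanSpace ℝ (Fin d) → ℝ, IsCb1 f →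
      ∫ ω, gradient f (X ω) ∂P = ∫ ω, f (X ω) • N ω ∂P)
    {U : EuclideanSpace ℝ (Fin d) → EuclideanSpace ℝ (Fin d)} (hU : ContDiff ℝ 1 U)
    (hUc : HasCompactSupport U) {f : EuclideanSpace ℝ (Fin d) → ℝ} (hf : ContDiff ℝ 1 f) :
    Integrable (fun ω => fderiv ℝ f (X ω) (U (X ω))) P ∧
      Integrable (fun ω => f (X ω) * (⟪U (X ω), N ω⟫_ℝ - euclideanDiv U (X ω))) P ∧
      ∫ ω, fderiv ℝ f (X ω) (U (X ω)) ∂P =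
        ∫ ω, f (X ω) * (⟪U (X ω), N ω⟫_ℝ - euclideanDiv U (X ω)) ∂P := by
  let b : Fin d → EuclideanSpace ℝ (Fin d) := fun i => EuclideanSpace.single i 1
  have hcomp : ∀ g : EuclideanSpace ℝ (Fin d) → ℝ, Continuous g → HasCompactSupport g →
      Integrable (fun ω => g (X ω)) P := by
    intro g hg hgc
    obtain ⟨C, hC⟩ := hgc.exists_bound_of_continuous hg
    exact Integrable.of_bound (hg.measurable.comp hX).aestronglyMeasurable C
      (.of_forall fun ω => hC _)
  have hUi : ∀ i, ContDiff ℝ 1 fun x => U x i := fun i =>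
    (EuclideanSpace.proj (𝕜 := ℝ) i).contDiff.comp hU
  have hUic : ∀ i, HasCompactSupport fun x => U x i := fun i =>
    hUc.comp_left (g := fun w : EuclideanSpace ℝ (Fin d) => w i) (by simp)
  have hCb : ∀ i, IsCb1 fun x => f x * U x i := fun i =>
    .of_hasCompactSupport (hf.mul (hUi i)) (hUic i).mul_left
  have hdf : ∀ i, Continuous fun x => fderiv ℝ f x (b i) := fun i =>
    (hf.continuous_fderiv one_ne_zero).clm_apply continuous_const
  have hdU : ∀ i, Continuous fun x => (fderiv ℝ U x (b i)) i := fun i =>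
    (EuclideanSpace.proj (𝕜 := ℝ) i).continuous.comp
      ((hU.continuous_fderiv one_ne_zero).clm_apply continuous_const)
  have hdUc : ∀ i, HasCompactSupport fun x => (fderiv ℝ U x (b i)) i := fun i =>
    (hUc.fderiv ℝ).comp_left
      (g := fun A : EuclideanSpace ℝ (Fin d) →L[ℝ] EuclideanSpace ℝ (Fin d) => (A (b i)) i)
      (by simp)
  have hA : ∀ i, Integrable (fun ω => U (X ω) i * fderiv ℝ f (X ω) (b i)) P := fun i =>
    hcomp _ ((hUi i).continuous.mul (hdf i)) (hUic i).mul_right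
  have hB : ∀ i, Integrable (fun ω => f (X ω) * (fderiv ℝ U (X ω) (b i)) i) P := fun i =>
    hcomp _ (hf.continuous.mul (hdU i)) (hdUc i).mul_left
  have hC : ∀ i, Integrable (fun ω => f (X ω) * U (X ω) i * N ω i) P := fun i =>
    ((EuclideanSpace.proj (𝕜 := ℝ) i).integrable_comp ((hCb i).integrable_smul hX hN)).congr
      (.of_forall fun ω => by simp)
  have hCB : ∀ i, Integrable
      (fun ω => f (X ω) * U (X ω) i * N ω i - f (X ω) * (fderiv ℝ U (X ω) (b i)) i) P :=
    fun i => (hC i).sub (hB i)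
  have hibp : ∀ i, ∫ ω, U (X ω) i * fderiv ℝ f (X ω) (b i) ∂P =
      ∫ ω, (f (X ω) * U (X ω) i * N ω i - f (X ω) * (fderiv ℝ U (X ω) (b i)) i) ∂P := by
    intro i
    have h := integral_fderiv_apply_eq hX hN hIBP (hCb i) (b i)
    simp only [fderiv_mul_apply_single (hf.differentiable one_ne_zero)
      (hU.differentiable one_ne_zero)] at h
    rw [integral_add (hA i) (hB i)] at h
    rw [integral_sub (hC i) (hB i), eq_sub_iff_add_eq, h]
    simp [b, EuclideanSpace.inner_single_left]
  have hleft : (fun ω => fderiv ℝ f (X ω) (U (X ω))) =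
      fun ω => ∑ i, U (X ω) i * fderiv ℝ f (X ω) (b i) := by
    funext ω
    conv_lhs => rw [← (EuclideanSpace.basisFun (Fin d) ℝ).sum_repr (U (X ω)), map_sum]
    simp [b]
  have hright : (fun ω => f (X ω) * (⟪U (X ω), N ω⟫_ℝ - euclideanDiv U (X ω))) =
      fun ω => ∑ i, (f (X ω) * U (X ω) i * N ω i - f (X ω) * (fderiv ℝ U (X ω) (b i)) i) := by
    funext ω
    rw [Finset.sum_sub_distrib, ← Finset.mul_sum, mul_sub, euclideanDiv, PiLp.inner_apply,
      Finset.mul_sum]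
    congr 1
    refine Finset.sum_congr rfl fun i _ => ?_
    simp only [RCLike.inner_apply, conj_trivial]
    ring
  rw [hleft, hright]
  refine ⟨integrable_finsetSum _ fun i _ => hA i,
    integrable_finsetSum _ fun i _ => hCB i, ?_⟩
  rw [integral_finsetSum _ fun i _ => hA i, integral_finsetSum _ fun i _ => hCB i]
  exact Finset.sum_congr rfl fun i _ => hibp i

/-! ### Density and its logarithmic gradient -/

/-- For test functions, integration by parts against the law of `X` says exactly that the density
has weak gradient `-ρ E(N | X = ·)`. -/
theorem hasWeakGradient_rnDeriv [IsProbabilityMeasure P] (hX : Measurable X)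
    (hN : Integrable N P)
    (hIBP : ∀ f : EuclideanSpace ℝ (Fin d) → ℝ, IsCb1 f →
      ∫ ω, gradient f (X ω) ∂P = ∫ ω, f (X ω) • N ω ∂P) :
    HasWeakGradient (fun x => ((P.map X).rnDeriv volume x).toReal)
      (fun x => -(((P.map X).rnDeriv volume x).toReal • condMeanGiven P N X x)) := by
  have := Measure.isProbabilityMeasure_map (μ := P) hX.aemeasurable
  have hac := map_absolutelyContinuous_volume hX hN hIBP
  refine ⟨Measure.integrable_toReal_rnDeriv.locallyIntegrable,
    ((integrable_rnDeriv_smul_iff hac).2 (integrable_condMeanGiven hX hN)).neg.locallyIntegrable,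
    fun φ hφ hφc => ?_⟩
  have hCb : IsCb1 φ := .of_hasCompactSupport (hφ.of_le (by exact_mod_cast le_top)) hφc
  have hgrad : Continuous (gradient φ) :=
    (InnerProductSpace.toDual ℝ _).symm.continuous.comp (hCb.1.continuous_fderiv one_ne_zero)
  rw [integral_rnDeriv_smul hac, integral_map hX.aemeasurable hgrad.aestronglyMeasurable,
    hIBP φ hCb, ← integral_smul_condMeanGiven hX hN hCb, ← integral_rnDeriv_smul hac,
    ← integral_neg]
  refine integral_congr_ae (.of_forall fun x => ?_)
  simp only [smul_neg, neg_neg]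
  exact smul_comm _ _ _

end

theorem theoremT4p1 {Ω : Type*} [MeasurableSpace Ω] (P : Measure Ω) [IsProbabilityMeasure P]
    (d : ℕ) (hd : 1 ≤ d) (X N : Ω → EuclideanSpace ℝ (Fin d))
    (hX : Measurable X) (hN : MemLp N 2 P)
    (hIBP : ∀ f : EuclideanSpace ℝ (Fin d) → ℝ, IsCb1 f →
      ∫ ω, gradient f (X ω) ∂P = ∫ ω, f (X ω) • N ω ∂P) :
    (∃ (ρ : EuclideanSpace ℝ (Fin d) → ℝ)
        (G : EuclideanSpace ℝ (Fin d) → EuclideanSpace ℝ (Fin d)),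
      Measurable ρ ∧ (∀ x, 0 ≤ ρ x) ∧
      P.map X = volume.withDensity (fun x => ENNReal.ofReal (ρ x)) ∧
      HasWeakGradient ρ G ∧
      (∀ᵐ x ∂(P.map X), logGradient ρ G x = -condMeanGiven P N X x) ∧
      ∀ (e : EuclideanSpace ℝ (Fin d)) (H : ℝ → ℝ),
        ConvexOn ℝ (Set.Ici 0) H → MonotoneOn H (Set.Ici 0) → (∀ r, 0 ≤ r → 0 ≤ H r) →
        ∫⁻ x, ENNReal.ofReal (H |⟪e, logGradient ρ G x⟫_ℝ| * ρ x) ≤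
          ∫⁻ ω, ENNReal.ofReal (H |⟪e, N ω⟫_ℝ|) ∂P) ∧
    (∀ U : EuclideanSpace ℝ (Fin d) → EuclideanSpace ℝ (Fin d),
      ContDiff ℝ 1 U → HasCompactSupport U →
      ∀ f : EuclideanSpace ℝ (Fin d) → ℝ, ContDiff ℝ 1 f →
        Integrable (fun ω => fderiv ℝ f (X ω) (U (X ω))) P ∧
        Integrable (fun ω => f (X ω) * (⟪U (X ω), N ω⟫_ℝ - euclideanDiv U (X ω))) P ∧
        ∫ ω, fderiv ℝ f (X ω) (U (X ω)) ∂P =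
          ∫ ω, f (X ω) * (⟪U (X ω), N ω⟫_ℝ - euclideanDiv U (X ω)) ∂P) := by
  have hN1 : Integrable N P := hN.integrable one_le_two
  refine ⟨?_, fun U hU hUc f hf => integral_fderiv_apply_vectorField hX hN1 hIBP hU hUc hf⟩
  have := Measure.isProbabilityMeasure_map (μ := P) hX.aemeasurable
  have hac := map_absolutelyContinuous_volume hX hN1 hIBP
  set ρ : EuclideanSpace ℝ (Fin d) → ℝ := fun x => ((P.map X).rnDeriv volume x).toReal with hρ
  set G : EuclideanSpace ℝ (Fin d) → EuclideanSpace ℝ (Fin d) :=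
    fun x => -(ρ x • condMeanGiven P N X x) with hG
  have hρm : Measurable ρ := (Measure.measurable_rnDeriv _ _).ennreal_toReal
  have hρ0 : ∀ x, 0 ≤ ρ x := fun x => ENNReal.toReal_nonneg
  have hdens : P.map X = volume.withDensity (fun x => ENNReal.ofReal (ρ x)) := by
    conv_lhs => rw [← Measure.withDensity_rnDeriv_eq _ _ hac]
    refine withDensity_congr_ae ?_
    filter_upwards [(P.map X).rnDeriv_ne_top volume] with x hx
    exact (ENNReal.ofReal_toReal hx).symm
  have hlog : ∀ x, ρ x ≠ 0 → logGradient ρ G x = -condMeanGiven P N X x := by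
    intro x hx
    rw [logGradient, hG, smul_neg, inv_smul_smul₀ hx]
  refine ⟨ρ, G, hρm, hρ0, hdens, hasWeakGradient_rnDeriv hX hN1 hIBP, ?_, ?_⟩
  · filter_upwards [Measure.rnDeriv_pos hac,
      hac.ae_le ((P.map X).rnDeriv_ne_top volume)] with x hx hx'
    exact hlog x (ENNReal.toReal_pos hx.ne' hx').ne'
  · intro e H hH hmono hH0
    have hφ := hH.comp_abs hmono
    have hcont : Continuous fun r => H |r| := continuousOn_univ.1 (hφ.continuousOn isOpen_univ)
    refine le_trans (le_of_eq ?_) (lintegral_convex_inner_condMeanGiven_le hX hN1 e hφ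
      fun r => hH0 _ (abs_nonneg r))
    conv_rhs => rw [hdens]
    have hmeas : Measurable fun x => ENNReal.ofReal (H |⟪e, condMeanGiven P N X x⟫_ℝ|) :=
      (hcont.measurable.comp (measurable_condMeanGiven.const_inner)).ennreal_ofReal
    rw [lintegral_withDensity_eq_lintegral_mul _ hρm.ennreal_ofReal hmeas]
    refine lintegral_congr fun x => ?_
    -- Where `ρ` vanishes, both integrands are `0`, whatever the logarithmic gradient is.
    by_cases hx : ρ x = 0
    · simp [hx]
    · rw [hlog x hx, inner_neg_right, abs_neg, ENNReal.ofReal_mul (hH0 _ (abs_nonneg _)),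
        mul_comm, Pi.mul_apply]
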